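/- For a finite set $V\subset\mathbb R^d$, a geometric graph on $V$ is a simple graph with vertex set $V$; its edges are weighted by their Euclidean lengths, $\mathrm{dist}(p,q)$ is the Euclidean distance, and $\mathrm{dist}_G(p,q)$ is the Euclidean length of a shortest path from $p$ to $q$ in $G$, with $\mathrm{dist}_G(p,q)=\infty$ if $p$ and $q$ lie in different components. The graph $G$ is a $t$-spanner of $X\subseteq V$ if $\mathrm{dist}_G(p,q)/\mathrm{dist}(p,q)\le t$ for every pair of distinct $p,q\in X$. A geometric graph $G=(P,E)$ is an $\varepsilon$-resilient $t$-spanner if for every $F\subseteq P$ there is a set $F^+$ with $F\subseteq F^+\subseteq P$ and $|F^+|\le(1+\varepsilon)|F|$ such that $G-F$, the subgraph of $G$ induced on $P\setminus F$, is a $t$-spanner of $P\setminus F^+$. **Theorem.** For every integer $d\ge 1$ and all real numbers $\varepsilon>0$ and $t>1$ there is a constant $C$, depending only on $d$, $\varepsilon$ and $t$, such that every finite set $P\subset\mathbb R^d$ with $n=|P|$ points has an $\varepsilon$-resilient $t$-spanner $G=(P,E)$ which, if $n\ge 3$, satisfies $$|E|\le C\,n\,(\log n)^2\,\log\log n .$$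 -/

import Mathlib

open scoped ENNReal

namespace GeometricGraph

/-- The Euclidean length of a walk: the sum of the lengths of its edges. -/
noncomputable def walkLength {V : Type*} [MetricSpace V] {G : SimpleGraph V} {u v : V}
    (w : G.Walk u v) : ℝ :=
  (w.darts.map (fun e => dist e.fst e.snd)).sum

/-- The shortest-path distance in a geometric graph, where each edge is weighted by its length.
It is `∞` when `u` and `v` lie in different components. -/
noncomputable def graphDist {V : Type*} [MetricSpace V] (G : SimpleGraph V) (u v : V) : ℝ≥0∞ :=
  ⨅ w : G.Walk u v, ENNReal.ofReal (walkLength w)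

/-- `G` is a geometric `t`-spanner of the subset `X` of its vertex set. -/
def IsSpannerOf {V : Type*} [MetricSpace V] (G : SimpleGraph V) (t : ℝ) (X : Set V) : Prop :=
  ∀ p ∈ X, ∀ q ∈ X, p ≠ q → graphDist G p q / edist p q ≤ ENNReal.ofReal t

/-- `G` is an `f(k)`-robust `t`-spanner: for every set `F` of vertices there is `F⁺ ⊇ F` with
`|F⁺| ≤ f(|F|)` such that `G - F` (the subgraph induced on the vertices outside `F`) is a
`t`-spanner of the set of vertices outside `F⁺`. -/
def IsRobustSpanner {V : Type*} [MetricSpace V] (G : SimpleGraph V) (f : ℕ → ℝ) (t : ℝ) : Prop :=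
  ∀ F : Finset V, ∃ Fplus : Finset V, F ⊆ Fplus ∧ (Fplus.card : ℝ) ≤ f F.card ∧
    IsSpannerOf (G.induce {v : V | v ∉ F}) t {v | (v : V) ∉ Fplus}

/-- An `ε`-resilient `t`-spanner is a `(1 + ε)k`-robust `t`-spanner. -/
def IsResilientSpanner {V : Type*} [MetricSpace V] (G : SimpleGraph V) (ε t : ℝ) : Prop :=
  IsRobustSpanner G (fun k => (1 + ε) * k) t

end GeometricGraph

/-!
The idea is to reduce resilience to counting in a pair decomposition of small load.

For `δ` small in terms of `t`, there is a family of pairs `(A, B)` of subsets of `P` with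
`|A| ≤ |B|` such that every point lies in `O(log n)` of the sets, and any two points are split by a
pair `(A, B)` such that `B` lies within `δ` times their distance of the point it contains
(`exists_semiseparated_pairs`). Each pair is equipped with a bipartite graph in which every point of
`A` has `D ≈ η⁻¹ log η⁻¹` neighbours in `B`, where `η ≈ ε / log n`, with this expansion: a set `X`
missing at least an `η`-fraction of `B` contains all neighbours of at most `η |X|` points of `A`
(`exists_expander`, by a union bound over random neighbourhoods). This gives
`O(n log n) * O(log n log log n)` edges.

Given `F`, close it up under two rules: a set `B` of which less than an `η`-fraction survives is
swallowed, and otherwise a point of `A` with no surviving neighbour in `B` dies. Each pair is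
responsible for at most `2η |F⁺ ∩ B|` deaths, so that logarithmic load bounds the damage by
`(1 + ε) |F|` (`exists_damaged_superset`). If `p ∈ A` and `q ∈ B` survive, then `p` has a surviving
neighbour `r ∈ B`, which is much closer to `q` than `p` is; continuing from `r` by induction on the
distance gives a short path (`isSpannerOf_of_forall_exists_adj`).

The pair decomposition comes from a quadtree, seen as a trie of digit sequences. In a trie with `n`
words take a node with more than `n / 2` words all of whose children have at most `n / 2`: pair
the words outside the node with those inside, pair the children with one another, and recurse on
the outside and on the children. All recursive calls halve the size (`exists_pairs_of_digits`). To
ensure that the cells in which two points first differ are small compared with their distance, the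
decompositions for `2 ^ d` grids, translated by `0` or `1 / 3` in each coordinate, are united; each
trie uses only every `h`-th level of its grid, and there is one for each residue modulo `h`.
-/

namespace GeometricGraph

/-! ### Pair decompositions of tries -/

/-- A finite set of at least two points with pairwise different digit sequences has a prefix class
which contains more than half of the points, while each of its children contains at most half. -/
theorem exists_heavy_prefix {V ι : Type*} [DecidableEq ι]
    (dig : V → ℕ → ι) (Q : Finset V) (hQ : 2 ≤ Q.card)
    (hsep : ∀ p ∈ Q, ∀ q ∈ Q, p ≠ q → ∃ i, dig p i ≠ dig q i) :
    ∃ x ∈ Q, ∃ j, Q.card < 2 * (Q.filter fun y => ∀ i < j, dig y i = dig x i).card ∧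
      ∀ a, 2 * (Q.filter fun y => (∀ i < j, dig y i = dig x i) ∧ dig y j = a).card ≤ Q.card := by
  by_contra! hcon
  have heavy : ∀ j, ∃ x ∈ Q, Q.card < 2 * (Q.filter fun y => ∀ i < j, dig y i = dig x i).card := by
    intro j
    induction j with
    | zero =>
      obtain ⟨x, hx⟩ : Q.Nonempty := Finset.card_pos.mp (by omega)
      refine ⟨x, hx, ?_⟩
      simp only [Nat.not_lt_zero, false_imp_iff, implies_true, Finset.filter_true]
      omega
    | succ j ih =>
      obtain ⟨x, hx, hlt⟩ := ih
      obtain ⟨a, ha⟩ := hcon x hx j hlt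
      obtain ⟨y, hy⟩ : (Q.filter fun y => (∀ i < j, dig y i = dig x i) ∧ dig y j = a).Nonempty :=
        Finset.card_pos.mp (by omega)
      rw [Finset.mem_filter] at hy
      refine ⟨y, hy.1, lt_of_lt_of_le ha (Nat.mul_le_mul_left 2 (Finset.card_le_card ?_))⟩
      intro z hz
      rw [Finset.mem_filter] at hz ⊢
      refine ⟨hz.1, fun i hi => ?_⟩
      rcases Nat.lt_succ_iff_lt_or_eq.mp hi with h | rfl
      · rw [hz.2.1 i h, hy.2.1 i h]
      · rw [hz.2.2, hy.2.2]
  have hsep' : ∀ p q : V, ∃ i, p ∈ Q → q ∈ Q → p ≠ q → dig p i ≠ dig q i := by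
    intro p q
    by_cases h : p ∈ Q ∧ q ∈ Q ∧ p ≠ q
    · obtain ⟨i, hi⟩ := hsep p h.1 q h.2.1 h.2.2
      exact ⟨i, fun _ _ _ => hi⟩
    · exact ⟨0, fun h1 h2 h3 => absurd ⟨h1, h2, h3⟩ h⟩
  choose D hD using hsep'
  obtain ⟨x, hx, hlt⟩ := heavy ((Q ×ˢ Q).sup (fun z => D z.1 z.2) + 1)
  have h1 : (Q.filter fun y => ∀ i < (Q ×ˢ Q).sup (fun z => D z.1 z.2) + 1,
      dig y i = dig x i) ⊆ {x} := by
    intro y hy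
    rw [Finset.mem_filter] at hy
    rw [Finset.mem_singleton]
    by_contra hne
    refine hD y x hy.1 hx hne (hy.2 _ (Nat.lt_succ_of_le ?_))
    exact Finset.le_sup (f := fun z : V × V => D z.1 z.2) (b := (y, x))
      (Finset.mk_mem_product hy.1 hx)
  have h2 := Finset.card_le_card h1
  rw [Finset.card_singleton] at h2
  omega

/-- The pair decomposition of a trie. The points of `V` are described by digit sequences; each
point lies in logarithmically many of the pairs, and whenever `p` and `q` first differ in digit `i`,
they are split by a pair whose second, larger component consists of points that agree up to and
including digit `i` with the one of `p`, `q` it contains. -/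
theorem exists_pairs_of_digits {V ι : Type*} [DecidableEq V] [Fintype ι] [DecidableEq ι]
    (dig : V → ℕ → ι) (k : ℕ) : ∀ Q : Finset V, Q.card ≤ 2 ^ k →
    (∀ p ∈ Q, ∀ q ∈ Q, p ≠ q → ∃ i, dig p i ≠ dig q i) →
    ∃ S : Finset (Finset V × Finset V),
      (∀ s ∈ S, s.1 ⊆ Q ∧ s.2 ⊆ Q ∧ s.1.card ≤ s.2.card) ∧
      (∀ v, (S.filter fun s => v ∈ s.1 ∨ v ∈ s.2).card ≤ (2 * Fintype.card ι + 1) * k) ∧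
      ∀ p ∈ Q, ∀ q ∈ Q, ∀ i, (∀ j < i, dig p j = dig q j) → dig p i ≠ dig q i → ∃ s ∈ S,
        (p ∈ s.1 ∧ q ∈ s.2 ∧ ∀ b ∈ s.2, ∀ j ≤ i, dig b j = dig q j) ∨
        (q ∈ s.1 ∧ p ∈ s.2 ∧ ∀ b ∈ s.2, ∀ j ≤ i, dig b j = dig p j) := by
  have small : ∀ Q : Finset V, Q.card ≤ 1 → ∀ p ∈ Q, ∀ q ∈ Q, ∀ i, dig p i ≠ dig q i → False := by
    intro Q hQ p hp q hq i h
    exact h (by rw [Finset.card_le_one.mp hQ p hp q hq])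
  induction k with
  | zero =>
    intro Q hQ _
    exact ⟨∅, by simp, by simp, fun p hp q hq i _ h => (small Q (by simpa using hQ) p hp q hq i h).elim⟩
  | succ k ih =>
    intro Q hQ hsep
    rcases Nat.lt_or_ge Q.card 2 with h1 | h2
    · exact ⟨∅, by simp, by simp, fun p hp q hq i _ h =>
        (small Q (by omega) p hp q hq i h).elim⟩
    obtain ⟨x, hx, j, hw, hc⟩ := exists_heavy_prefix dig Q h2 hsep
    set w := Q.filter fun y => ∀ i < j, dig y i = dig x i with hwdef
    set c : ι → Finset V := fun a => Q.filter fun y => (∀ i < j, dig y i = dig x i) ∧ dig y j = a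
      with hcdef
    have memw : ∀ y, y ∈ w ↔ y ∈ Q ∧ ∀ i < j, dig y i = dig x i := fun y => Finset.mem_filter
    have memc : ∀ y a, y ∈ c a ↔ y ∈ Q ∧ (∀ i < j, dig y i = dig x i) ∧ dig y j = a :=
      fun y a => Finset.mem_filter
    have hwQ : w ⊆ Q := Finset.filter_subset _ _
    have hcQ : ∀ a, c a ⊆ Q := fun a => Finset.filter_subset _ _
    have hLcard : (Q \ w).card + w.card = Q.card := Finset.card_sdiff_add_card_eq_card hwQ
    have hpow : 2 ^ (k + 1) = 2 * 2 ^ k := by ring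
    obtain ⟨SL, hSL1, hSL2, hSL3⟩ := ih (Q \ w) (by omega) (fun p hp q hq =>
      hsep p (Finset.sdiff_subset hp) q (Finset.sdiff_subset hq))
    have ihc : ∀ a, _ := fun a => ih (c a) (by have h : 2 * (c a).card ≤ Q.card := hc a; omega) (fun p hp q hq =>
      hsep p (hcQ a hp) q (hcQ a hq))
    choose Sc hSc1 hSc2 hSc3 using ihc
    set T : Finset (Finset V × Finset V) :=
      ((Finset.univ : Finset (ι × ι)).filter fun z => (c z.1).card ≤ (c z.2).card ∧ z.1 ≠ z.2).image
        fun z => (c z.1, c z.2) with hT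
    refine ⟨{(Q \ w, w)} ∪ T ∪ SL ∪ Finset.univ.biUnion Sc, ?_, ?_, ?_⟩
    · intro s hs
      simp only [Finset.mem_union, Finset.mem_singleton, Finset.mem_biUnion, Finset.mem_univ,
        true_and, hT, Finset.mem_image, Finset.mem_filter] at hs
      rcases hs with ((rfl | ⟨z, hz, rfl⟩) | hs) | ⟨a, hs⟩
      · exact ⟨Finset.sdiff_subset, hwQ, by dsimp only; omega⟩
      · exact ⟨hcQ _, hcQ _, hz.1⟩
      · obtain ⟨h1, h2, h3⟩ := hSL1 s hs
        exact ⟨h1.trans Finset.sdiff_subset, h2.trans Finset.sdiff_subset, h3⟩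
      · obtain ⟨h1, h2, h3⟩ := hSc1 a s hs
        exact ⟨h1.trans (hcQ a), h2.trans (hcQ a), h3⟩
    · intro v
      -- Only one of the recursive families contains pairs through `v`.
      obtain ⟨R, hR1, hR2⟩ : ∃ R : Finset (Finset V × Finset V),
          R.card ≤ (2 * Fintype.card ι + 1) * k ∧
          ((SL ∪ Finset.univ.biUnion Sc).filter fun s : Finset V × Finset V =>
            v ∈ s.1 ∨ v ∈ s.2) ⊆ R := by
        by_cases hv : v ∈ w
        · refine ⟨_, hSc2 (dig v j) v, fun s hs => ?_⟩
          simp only [Finset.mem_filter, Finset.mem_union, Finset.mem_biUnion, Finset.mem_univ,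
            true_and] at hs ⊢
          refine ⟨?_, hs.2⟩
          rcases hs.1 with h | ⟨a, h⟩
          · have hv' : v ∈ Q \ w := hs.2.elim (fun h' => (hSL1 s h).1 h')
              (fun h' => (hSL1 s h).2.1 h')
            exact absurd hv (Finset.mem_sdiff.mp hv').2
          · have hv' : v ∈ c a := hs.2.elim (fun h' => (hSc1 a s h).1 h')
              (fun h' => (hSc1 a s h).2.1 h')
            rw [((memc v a).mp hv').2.2]
            exact h
        · refine ⟨_, hSL2 v, fun s hs => ?_⟩
          simp only [Finset.mem_filter, Finset.mem_union, Finset.mem_biUnion, Finset.mem_univ,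
            true_and] at hs ⊢
          refine ⟨?_, hs.2⟩
          rcases hs.1 with h | ⟨a, h⟩
          · exact h
          · have hv' : v ∈ c a := hs.2.elim (fun h' => (hSc1 a s h).1 h')
              (fun h' => (hSc1 a s h).2.1 h')
            have := (memc v a).mp hv'
            exact absurd ((memw v).mpr ⟨this.1, this.2.1⟩) hv
      have hT2 : (T.filter fun s => v ∈ s.1 ∨ v ∈ s.2) ⊆
          (Finset.univ.image fun b => (c (dig v j), c b)) ∪
          (Finset.univ.image fun b => (c b, c (dig v j))) := by
        intro s hs
        simp only [hT, Finset.mem_filter, Finset.mem_image, Finset.mem_union, Finset.mem_univ,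
          true_and] at hs ⊢
        obtain ⟨⟨z, hz, rfl⟩, hv | hv⟩ := hs
        · exact Or.inl ⟨z.2, by rw [((memc v z.1).mp hv).2.2]⟩
        · exact Or.inr ⟨z.1, by rw [((memc v z.2).mp hv).2.2]⟩
      have hT3 : (T.filter fun s => v ∈ s.1 ∨ v ∈ s.2).card ≤ 2 * Fintype.card ι := by
        refine (Finset.card_le_card hT2).trans ((Finset.card_union_le _ _).trans ?_)
        have h1 := Finset.card_image_le (s := (Finset.univ : Finset ι))
          (f := fun b => (c (dig v j), c b))
        have h2 := Finset.card_image_le (s := (Finset.univ : Finset ι))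
          (f := fun b => (c b, c (dig v j)))
        rw [Finset.card_univ] at h1 h2
        omega
      rw [Finset.union_assoc, Finset.filter_union, Finset.filter_union]
      refine (Finset.card_union_le _ _).trans ?_
      have h1 := Finset.card_union_le
        ((({(Q \ w, w)} : Finset (Finset V × Finset V))).filter fun s => v ∈ s.1 ∨ v ∈ s.2)
        (T.filter fun s => v ∈ s.1 ∨ v ∈ s.2)
      have h3 := Finset.card_filter_le ({(Q \ w, w)} : Finset (Finset V × Finset V))
        (fun s => v ∈ s.1 ∨ v ∈ s.2)
      rw [Finset.card_singleton] at h3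
      have h4 := (Finset.card_le_card hR2).trans hR1
      calc _ ≤ (1 + 2 * Fintype.card ι) + (2 * Fintype.card ι + 1) * k := by omega
        _ = _ := by ring
    · intro p hp q hq i hlt hne
      by_cases hpw : p ∈ w <;> by_cases hqw : q ∈ w
      · have hp' := ((memw p).mp hpw).2
        have hq' := ((memw q).mp hqw).2
        by_cases heq : dig p j = dig q j
        · obtain ⟨s, hs, h⟩ := hSc3 (dig q j) p ((memc _ _).mpr ⟨hp, hp', heq⟩) q
            ((memc _ _).mpr ⟨hq, hq', rfl⟩) i hlt hne
          exact ⟨s, Finset.mem_union_right _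
            (Finset.mem_biUnion.mpr ⟨_, Finset.mem_univ _, hs⟩), h⟩
        · have hij : i = j := by
            rcases lt_trichotomy i j with h | h | h
            · exact absurd ((hp' i h).trans (hq' i h).symm) hne
            · exact h
            · exact absurd (hlt j h) heq
          have key : ∀ r ∈ w, ∀ b ∈ c (dig r j), ∀ l ≤ i, dig b l = dig r l := by
            intro r hr b hb l hl
            rw [memc] at hb
            rcases Nat.lt_or_eq_of_le (hl.trans hij.le) with h | h
            · rw [hb.2.1 l h, ((memw r).mp hr).2 l h]
            · rw [h, hb.2.2]
          have memT : ∀ a b, (c a).card ≤ (c b).card → a ≠ b →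
              (c a, c b) ∈ {(Q \ w, w)} ∪ T ∪ SL ∪ Finset.univ.biUnion Sc := by
            intro a b h h'
            refine Finset.mem_union_left _ (Finset.mem_union_left _ (Finset.mem_union_right _ ?_))
            exact Finset.mem_image.mpr ⟨(a, b), by simp [h, h'], rfl⟩
          have hpc : p ∈ c (dig p j) := (memc _ _).mpr ⟨hp, hp', rfl⟩
          have hqc : q ∈ c (dig q j) := (memc _ _).mpr ⟨hq, hq', rfl⟩
          rcases le_total (c (dig p j)).card (c (dig q j)).card with h | h
          · exact ⟨_, memT _ _ h heq, Or.inl ⟨hpc, hqc, key q hqw⟩⟩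
          · exact ⟨_, memT _ _ h (Ne.symm heq), Or.inr ⟨hqc, hpc, key p hpw⟩⟩
      · have hij : i < j := by
          by_contra h
          exact hqw ((memw q).mpr ⟨hq, fun l hl => by
            rw [← hlt l (by omega), ((memw p).mp hpw).2 l hl]⟩)
        exact ⟨(Q \ w, w), by simp, Or.inr ⟨Finset.mem_sdiff.mpr ⟨hq, hqw⟩, hpw, fun b hb l hl => by
          rw [((memw b).mp hb).2 l (by omega), ((memw p).mp hpw).2 l (by omega)]⟩⟩
      · have hij : i < j := by
          by_contra h
          exact hpw ((memw p).mpr ⟨hp, fun l hl => by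
            rw [hlt l (by omega), ((memw q).mp hqw).2 l hl]⟩)
        exact ⟨(Q \ w, w), by simp, Or.inl ⟨Finset.mem_sdiff.mpr ⟨hp, hpw⟩, hqw, fun b hb l hl => by
          rw [((memw b).mp hb).2 l (by omega), ((memw q).mp hqw).2 l (by omega)]⟩⟩
      · obtain ⟨s, hs, h⟩ := hSL3 p (Finset.mem_sdiff.mpr ⟨hp, hpw⟩) q
          (Finset.mem_sdiff.mpr ⟨hq, hqw⟩) i hlt hne
        exact ⟨s, Finset.mem_union_left _ (Finset.mem_union_right _ hs), h⟩

/-! ### Bipartite expanders -/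

theorem choose_le_exp (n k : ℕ) (hk : 1 ≤ k) (hn : 1 ≤ n) :
    (n.choose k : ℝ) ≤ Real.exp (k * (1 + Real.log (n / k))) := by
  have hk' : (0 : ℝ) < k := by exact_mod_cast hk
  have hn' : (0 : ℝ) < n := by exact_mod_cast hn
  have h1 : (n.choose k : ℝ) ≤ (n : ℝ) ^ k / k.factorial := Nat.choose_le_pow_div k n
  have h2 : (k : ℝ) ^ k / k.factorial ≤ Real.exp k := Real.pow_div_factorial_le_exp _ hk'.le k
  have h3 : Real.exp (k * (1 + Real.log (n / k))) = Real.exp k * (n / k : ℝ) ^ k := by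
    rw [mul_add, mul_one, Real.exp_add, mul_comm (k : ℝ) (Real.log _), Real.exp_mul,
      Real.exp_log (by positivity), Real.rpow_natCast]
  rw [h3]
  calc (n.choose k : ℝ) ≤ (n : ℝ) ^ k / k.factorial := h1
    _ = (k : ℝ) ^ k / k.factorial * (n / k : ℝ) ^ k := by rw [div_pow]; field_simp
    _ ≤ _ := by gcongr

theorem exp_neg_two_mul_le (n : ℕ) : Real.exp (-(2 * n)) ≤ (1 / 4 : ℝ) ^ n := by
  have h1 : Real.exp (-2) ≤ 1 / 4 := by
    have h2 : (4 : ℝ) ≤ Real.exp 2 := by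
      have := Real.add_one_le_exp (1 : ℝ)
      have h3 : Real.exp 2 = Real.exp 1 * Real.exp 1 := by rw [← Real.exp_add]; norm_num
      nlinarith
    rw [Real.exp_neg, one_div]
    exact inv_anti₀ (by norm_num) h2
  calc Real.exp (-(2 * n)) = Real.exp (-2) ^ n := by rw [← Real.exp_nat_mul]; ring_nf
    _ ≤ _ := by gcongr

/-- One term of the union bound for random neighbourhoods of size `D`: the expected number of
pairs of an `x`-set `X` and a `y`-set all of whose neighbours lie in `X`. -/
theorem union_bound_term {η : ℝ} (h0 : 0 < η) (h1 : η ≤ 1 / 2) {D : ℕ}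
    (hD : 30 / η * Real.log (1 / η) ≤ D) {N m x y : ℕ} (hmN : m ≤ N) (hx1 : 1 ≤ x)
    (hx : (x : ℝ) ≤ (1 - η) * N) (hy1 : 1 ≤ y) (hy : η * x ≤ y) :
    (N.choose x : ℝ) * m.choose y * ((x : ℝ) / N) ^ (D * y) ≤
      (1 / 4) ^ x + (1 / 4) ^ (N - x) := by
  have hx0 : (0 : ℝ) < x := by exact_mod_cast hx1
  have hy0 : (0 : ℝ) < y := by exact_mod_cast hy1
  have hN0 : (0 : ℝ) < N := by nlinarith [Nat.cast_nonneg (α := ℝ) N]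
  have hN1 : 1 ≤ N := by exact_mod_cast hN0
  have hxN : x < N := by
    have : (x : ℝ) < N := by nlinarith
    exact_mod_cast this
  set e := Real.log (1 / η) with he
  set l := Real.log (N / x) with hl
  have hlog2 : (0.69 : ℝ) < Real.log 2 := by linarith [Real.log_two_gt_d9]
  have he2 : Real.log 2 ≤ e :=
    Real.log_le_log (by norm_num) (by rw [le_div_iff₀ h0]; linarith)
  have hDη : 30 * e ≤ D * η := by
    have := mul_le_mul_of_nonneg_right hD h0.le
    calc 30 * e = 30 / η * e * η := by field_simp
      _ ≤ _ := this
  have hD0 : (0 : ℝ) ≤ D := Nat.cast_nonneg D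
  have hD2 : 60 * e ≤ D := by
    have := mul_le_mul_of_nonneg_left h1 hD0
    linarith
  have hpow : ((x : ℝ) / N) ^ (D * y) = Real.exp (-(D * y * l)) := by
    have : -(D * y * l) = ((D * y : ℕ) : ℝ) * Real.log (x / N) := by
      rw [hl, ← inv_div (x : ℝ) N, Real.log_inv]; push_cast; ring
    rw [this, Real.exp_nat_mul, Real.exp_log (by positivity)]
  have hcm : (m.choose y : ℝ) ≤ Real.exp (y * (1 + Real.log (N / y))) :=
    (Nat.cast_le.mpr (Nat.choose_le_choose y hmN)).trans (choose_le_exp N y hy1 hN1)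
  have hly : Real.log (N / y) ≤ l + e := by
    rw [hl, he, ← Real.log_mul (by positivity) (by positivity)]
    refine Real.log_le_log (by positivity) ?_
    rw [div_mul_div_comm, mul_one]
    exact div_le_div_of_nonneg_left hN0.le (by positivity) (by linarith)
  rcases le_or_gt (2 * (x : ℝ)) N with hc | hc
  · -- Small `X`: both entropy factors are absorbed by `(x / N) ^ (D * y)`.
    have hl2 : Real.log 2 ≤ l :=
      Real.log_le_log (by norm_num) (by rw [le_div_iff₀ hx0]; linarith)
    have hcx := choose_le_exp N x hx1 hN1
    rw [← hl] at hcx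
    have p1 : (3 + l) * x ≤ D / 2 * y * l := by
      have q1 : 15 * e * x ≤ D / 2 * y := by
        calc 15 * e * x ≤ D * η / 2 * x := by gcongr; linarith
          _ = D / 2 * (η * x) := by ring
          _ ≤ _ := by gcongr
      have q2 : 3 + l ≤ 15 * e * l := by
        have := mul_le_mul_of_nonneg_right (hlog2.le.trans he2) (by linarith : 0 ≤ l)
        linarith
      calc (3 + l) * x ≤ 15 * e * l * x := by gcongr
        _ = 15 * e * x * l := by ring
        _ ≤ _ := by
          have : 0 ≤ l := by linarith
          gcongr
    have p2 : (1 + l + e) * y ≤ D / 2 * y * l := by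
      have q2 : 1 + l + e ≤ 30 * e * l := by
        have r1 := mul_le_mul_of_nonneg_right (hlog2.le.trans he2) (by linarith : 0 ≤ l)
        have r2 := mul_le_mul_of_nonneg_left (hlog2.le.trans hl2) (by linarith : 0 ≤ e)
        linarith
      have q3 : 30 * e * l ≤ D / 2 * l := by gcongr <;> linarith
      calc (1 + l + e) * y ≤ (D / 2 * l) * y := by gcongr; linarith
        _ = _ := by ring
    have hmain : (x : ℝ) * (1 + l) + y * (1 + Real.log (N / y)) + -(D * y * l) ≤ -(2 * x) := by
      have := mul_le_mul_of_nonneg_left hly hy0.le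
      linarith
    have : (N.choose x : ℝ) * m.choose y * ((x : ℝ) / N) ^ (D * y) ≤ (1 / 4) ^ x := by
      rw [hpow]
      calc _ ≤ Real.exp (x * (1 + l)) * Real.exp (y * (1 + Real.log (N / y))) *
            Real.exp (-(D * y * l)) := by gcongr
        _ = Real.exp (x * (1 + l) + y * (1 + Real.log (N / y)) + -(D * y * l)) := by
            rw [Real.exp_add, Real.exp_add]
        _ ≤ Real.exp (-(2 * x)) := Real.exp_le_exp.mpr hmain
        _ ≤ _ := exp_neg_two_mul_le x
    have h4 : (0 : ℝ) ≤ (1 / 4) ^ (N - x) := by positivity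
    linarith
  · -- Large `X`: count its complement instead, which has at least `η * N` elements.
    obtain ⟨k, hk⟩ : ∃ k, N = x + k := ⟨N - x, by omega⟩
    have hk1 : 1 ≤ k := by omega
    have hk0 : (0 : ℝ) < k := by exact_mod_cast hk1
    have hkN : (N : ℝ) = x + k := by exact_mod_cast hk
    have hkη : η * N ≤ k := by linarith
    have hcx : (N.choose x : ℝ) ≤ Real.exp (k * (1 + e)) := by
      have : N.choose x = N.choose k := by
        rw [← Nat.choose_symm (by omega : x ≤ N)]; congr 1; omega
      rw [this]
      refine (choose_le_exp N k hk1 hN1).trans (Real.exp_le_exp.mpr ?_)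
      gcongr
      rw [he]
      refine Real.log_le_log (by positivity) ?_
      rw [div_le_div_iff₀ hk0 h0]; linarith
    have hl2 : l ≤ Real.log 2 :=
      Real.log_le_log (by positivity) (by rw [div_le_iff₀ hx0]; linarith)
    have hlz : (k : ℝ) / N ≤ l := by
      have h := Real.one_sub_inv_le_log_of_pos (x := (N : ℝ) / x) (by positivity)
      rw [inv_div] at h
      have : (k : ℝ) / N = 1 - x / N := by field_simp; linarith
      linarith
    have hηz : η ≤ (k : ℝ) / N := by rw [le_div_iff₀ hN0]; exact hkη
    have p1 : (3 + e) * k ≤ D / 2 * y * (k / N) := by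
      have q1 : η * N / 2 ≤ y := by
        have := mul_le_mul_of_nonneg_left hc.le h0.le
        linarith
      calc (3 + e) * k ≤ (D * η / 4) * k := by gcongr; linarith
        _ = D / 2 * (η * N / 2) * (k / N) := by
            have : (N : ℝ) * (k / N) = k := mul_div_cancel₀ _ hN0.ne'
            linear_combination (-(D * η / 4)) * this
        _ ≤ _ := by gcongr
    have p2 : (1 + 2 * e) * y ≤ D / 2 * y * (k / N) := by
      calc (1 + 2 * e) * y ≤ (D * η / 2) * y := by gcongr; linarith
        _ = D / 2 * y * η := by ring
        _ ≤ _ := by gcongr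
    have p3 : D * y * (k / N : ℝ) ≤ D * y * l := by gcongr
    have hmain : (k : ℝ) * (1 + e) + y * (1 + Real.log (N / y)) + -(D * y * l) ≤ -(2 * k) := by
      have r1 := mul_le_mul_of_nonneg_left hly hy0.le
      have r2 := mul_le_mul_of_nonneg_left (hl2.trans he2) hy0.le
      linarith
    have : (N.choose x : ℝ) * m.choose y * ((x : ℝ) / N) ^ (D * y) ≤ (1 / 4) ^ (N - x) := by
      rw [hpow]
      calc _ ≤ Real.exp (k * (1 + e)) * Real.exp (y * (1 + Real.log (N / y))) *
            Real.exp (-(D * y * l)) := by gcongr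
        _ = Real.exp (k * (1 + e) + y * (1 + Real.log (N / y)) + -(D * y * l)) := by
            rw [Real.exp_add, Real.exp_add]
        _ ≤ Real.exp (-(2 * k)) := Real.exp_le_exp.mpr hmain
        _ ≤ _ := exp_neg_two_mul_le k
        _ = _ := by congr 1; omega
    have h4 : (0 : ℝ) ≤ (1 / 4) ^ x := by positivity
    linarith

theorem sum_Ico_quarter_pow_le (N : ℕ) : ∑ x ∈ Finset.Ico 1 N, (1 / 4 : ℝ) ^ x ≤ 1 / 3 := by
  have h : ∀ n : ℕ, ∑ x ∈ Finset.Ico 1 (n + 1), (1 / 4 : ℝ) ^ x = (1 - (1 / 4) ^ n) / 3 := by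
    intro n
    induction n with
    | zero => simp
    | succ n ih => rw [Finset.sum_Ico_succ_top (by omega), ih]; ring
  rcases N with _ | n
  · norm_num
  · rw [h]
    have : (0 : ℝ) ≤ (1 / 4) ^ n := by positivity
    linarith

/-- The first moment bound: if every choice of `D` neighbours for each point failed to expand, then
the failing choices, sorted by the set `X` and the `⌊η |X|⌋ + 1` points trapped in it, would
exhaust all choices, but they make up at most two thirds of them. -/
theorem exists_expander_of_fintype {α β : Type*} [Fintype α] [Fintype β] [DecidableEq α]
    [DecidableEq β] (hab : Fintype.card α ≤ Fintype.card β) (hβ : 1 ≤ Fintype.card β)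
    {η : ℝ} (h0 : 0 < η) (h1 : η ≤ 1 / 2) {D : ℕ} (hD : 30 / η * Real.log (1 / η) ≤ D) :
    ∃ f : α → Fin D → β, ∀ X : Finset β, (X.card : ℝ) ≤ (1 - η) * Fintype.card β →
      ((Finset.univ.filter fun a => ∀ i, f a i ∈ X).card : ℝ) ≤ η * X.card := by
  by_contra! hcon
  set N := Fintype.card β with hN
  set m := Fintype.card α with hm
  have hN0 : (0 : ℝ) < N := by exact_mod_cast hβ
  have hD0 : D ≠ 0 := by
    rintro rfl
    have : 0 < 30 / η * Real.log (1 / η) :=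
      mul_pos (by positivity) (Real.log_pos (by rw [lt_div_iff₀ h0]; linarith))
    norm_num at hD this
    linarith
  set y : ℕ → ℕ := fun x => ⌊η * x⌋₊ + 1 with hy
  set bad : Finset β → Finset α → Finset (α → Fin D → β) := fun X Y =>
    Fintype.piFinset fun a => if a ∈ Y then Fintype.piFinset fun _ => X else Finset.univ with hbad
  have hbadcard : ∀ X Y, ((bad X Y).card : ℝ) =
      (N : ℝ) ^ (D * m) * ((X.card : ℝ) / N) ^ (D * Y.card) := by
    intro X Y
    have e1 : (bad X Y).card = X.card ^ (D * Y.card) * N ^ (D * (m - Y.card)) := by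
      rw [hbad]
      simp only [Fintype.card_piFinset, apply_ite Finset.card, Finset.prod_const, Finset.card_univ,
        Fintype.card_fin, Fintype.card_pi]
      rw [Finset.prod_ite, Finset.prod_const, Finset.prod_const, ← pow_mul, ← pow_mul]
      congr 2
      · congr 2; ext; simp
      · congr 1
        rw [← Finset.card_compl]
        congr 1; ext; simp
    have hYm : Y.card ≤ m := Finset.card_le_univ Y
    rw [e1]
    obtain ⟨r, hr⟩ : ∃ r, m = Y.card + r := ⟨m - Y.card, by omega⟩
    have : m - Y.card = r := by omega
    have hne : (N : ℝ) ^ (D * Y.card) ≠ 0 := pow_ne_zero _ hN0.ne'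
    rw [this, hr, div_pow, mul_add, pow_add, Nat.cast_mul, Nat.cast_pow, Nat.cast_pow]
    rw [mul_right_comm, mul_div_cancel₀ _ hne]
  set good : Finset (Finset β) := Finset.univ.filter fun X => (X.card : ℝ) ≤ (1 - η) * N with hgood
  have hcover : (Finset.univ : Finset (α → Fin D → β)) ⊆ good.biUnion fun X =>
      (Finset.powersetCard (y X.card) Finset.univ).biUnion fun Y => bad X Y := by
    intro f _
    obtain ⟨X, hX, hlt⟩ := hcon f
    have hle : y X.card ≤ (Finset.univ.filter fun a => ∀ i, f a i ∈ X).card :=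
      Nat.succ_le_of_lt ((Nat.floor_lt (by positivity)).mpr hlt)
    obtain ⟨Y, hY, hYc⟩ := Finset.exists_subset_card_eq hle
    refine Finset.mem_biUnion.mpr ⟨X, by simpa [hgood] using hX, Finset.mem_biUnion.mpr
      ⟨Y, Finset.mem_powersetCard.mpr ⟨Finset.subset_univ _, hYc⟩, ?_⟩⟩
    rw [hbad, Fintype.mem_piFinset]
    intro a
    split_ifs with ha
    · exact Fintype.mem_piFinset.mpr (Finset.mem_filter.mp (hY ha)).2
    · exact Finset.mem_univ _
  set g : ℕ → ℝ := fun x => if (x : ℝ) ≤ (1 - η) * N then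
    (m.choose (y x) : ℝ) * ((x : ℝ) / N) ^ (D * y x) else 0 with hg
  have hcount : (N : ℝ) ^ (D * m) ≤ (N : ℝ) ^ (D * m) * ∑ x ∈ Finset.range (N + 1),
      (N.choose x : ℝ) * g x := by
    have e1 : ((Finset.univ : Finset (α → Fin D → β)).card : ℝ) = (N : ℝ) ^ (D * m) := by
      rw [Finset.card_univ, Fintype.card_fun, Fintype.card_fun, Fintype.card_fin, pow_mul]
      push_cast; rfl
    have e2 : ∑ x ∈ Finset.range (N + 1), (N.choose x : ℝ) * g x =
        ∑ X : Finset β, g X.card := by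
      have := Finset.sum_powerset_apply_card g (x := (Finset.univ : Finset β))
      rw [Finset.powerset_univ, Finset.card_univ] at this
      rw [this]
      simp only [nsmul_eq_mul, hN]
    rw [← e1, e2]
    calc ((Finset.univ : Finset (α → Fin D → β)).card : ℝ)
        ≤ ((good.biUnion fun X => (Finset.powersetCard (y X.card) Finset.univ).biUnion
            fun Y => bad X Y).card : ℝ) := by exact_mod_cast Finset.card_le_card hcover
      _ ≤ ∑ X ∈ good, ∑ Y ∈ Finset.powersetCard (y X.card) Finset.univ,
            ((bad X Y).card : ℝ) := by
          have := (Finset.card_biUnion_le (s := good) (t := fun X =>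
            (Finset.powersetCard (y X.card) Finset.univ).biUnion fun Y => bad X Y)).trans
            (Finset.sum_le_sum fun X _ => Finset.card_biUnion_le)
          exact_mod_cast this
      _ = ∑ X ∈ good, (N : ℝ) ^ (D * m) * g X.card := by
          refine Finset.sum_congr rfl fun X hX => ?_
          have hX' : (X.card : ℝ) ≤ (1 - η) * N := by simpa [hgood] using hX
          have : ∀ Y ∈ Finset.powersetCard (y X.card) (Finset.univ : Finset α),
              ((bad X Y).card : ℝ) =
                (N : ℝ) ^ (D * m) * ((X.card : ℝ) / N) ^ (D * y X.card) := by
            intro Y hY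
            rw [hbadcard, (Finset.mem_powersetCard.mp hY).2]
          rw [Finset.sum_congr rfl this, Finset.sum_const, Finset.card_powersetCard,
            Finset.card_univ, nsmul_eq_mul]
          simp only [hg, if_pos hX']
          ring
      _ = ∑ X : Finset β, (N : ℝ) ^ (D * m) * g X.card := by
          rw [hgood, Finset.sum_filter]
          refine Finset.sum_congr rfl fun X _ => ?_
          by_cases h : (X.card : ℝ) ≤ (1 - η) * N
          · rw [if_pos h]
          · simp only [hg, if_neg h, mul_zero]
      _ = _ := by rw [← Finset.mul_sum, e1]
  have hsum : ∑ x ∈ Finset.range (N + 1), (N.choose x : ℝ) * g x ≤ 2 / 3 := by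
    have hterm : ∀ x ∈ Finset.range (N + 1), (N.choose x : ℝ) * g x ≤
        if x ∈ Finset.Ico 1 N then (1 / 4 : ℝ) ^ x + (1 / 4) ^ (N - x) else 0 := by
      intro x _
      by_cases hx : (x : ℝ) ≤ (1 - η) * N
      · simp only [hg, if_pos hx]
        rcases Nat.eq_zero_or_pos x with rfl | hx1
        · simp [hy, hD0]
        · have hxN : x < N := by
            have : (x : ℝ) < N := by nlinarith
            exact_mod_cast this
          rw [if_pos (Finset.mem_Ico.mpr ⟨hx1, hxN⟩), ← mul_assoc]
          refine union_bound_term h0 h1 hD hab hx1 hx (Nat.succ_pos _) ?_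
          have := Nat.lt_floor_add_one (η * x)
          simp only [hy]; push_cast; exact this.le
      · simp only [hg, if_neg hx, mul_zero]
        split_ifs <;> positivity
    refine (Finset.sum_le_sum hterm).trans ?_
    rw [← Finset.sum_filter]
    have hf : (Finset.range (N + 1)).filter (fun x => x ∈ Finset.Ico 1 N) = Finset.Ico 1 N := by
      ext x; simp only [Finset.mem_filter, Finset.mem_range, Finset.mem_Ico]; omega
    rw [hf, Finset.sum_add_distrib]
    have h2 := Finset.sum_Ico_reflect (fun x => (1 / 4 : ℝ) ^ x) 1 (Nat.le_succ N)
    have h3 : N + 1 - N = 1 := by omega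
    rw [h3, Nat.add_sub_cancel] at h2
    rw [h2]
    linarith [sum_Ico_quarter_pow_le N]
  have hpos : (0 : ℝ) < (N : ℝ) ^ (D * m) := by positivity
  nlinarith

/-- Random neighbourhoods of size `D ≈ η⁻¹ log η⁻¹` in `B` expand: a set `X` missing at least an
`η`-fraction of `B` contains the whole neighbourhood of at most `η |X|` elements of `A`. -/
theorem exists_expander {α β : Type*} [DecidableEq α] [DecidableEq β]
    (A : Finset α) (B : Finset β) (hAB : A.card ≤ B.card)
    {η : ℝ} (h0 : 0 < η) (h1 : η ≤ 1 / 2) {D : ℕ} (hD : 30 / η * Real.log (1 / η) ≤ D) :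
    ∃ nb : α → Finset β, (∀ a, nb a ⊆ B ∧ (nb a).card ≤ D) ∧
      ∀ X ⊆ B, (X.card : ℝ) ≤ (1 - η) * B.card →
        ((A.filter fun a => nb a ⊆ X).card : ℝ) ≤ η * X.card := by
  rcases Nat.eq_zero_or_pos B.card with hB | hB
  · have hA : A = ∅ := Finset.card_eq_zero.mp (by omega)
    subst hA
    exact ⟨fun _ => ∅, by simp, fun X _ _ => by
      simp only [Finset.filter_empty, Finset.card_empty, Nat.cast_zero]; positivity⟩
  obtain ⟨f, hf⟩ := exists_expander_of_fintype (α := A) (β := B) (by simpa using hAB)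
    (by simpa using hB) h0 h1 hD
  refine ⟨fun a => if h : a ∈ A then Finset.univ.image fun i => (f ⟨a, h⟩ i : β) else ∅, ?_, ?_⟩
  · intro a
    dsimp only
    split_ifs with h
    · refine ⟨fun b hb => ?_, Finset.card_image_le.trans (by simp)⟩
      obtain ⟨i, -, rfl⟩ := Finset.mem_image.mp hb
      exact (f ⟨a, h⟩ i).2
    · simp
  · intro X hXB hX
    have hXc : (X.subtype (· ∈ B)).card = X.card := by
      rw [Finset.card_subtype, Finset.filter_true_of_mem hXB]
    have := hf (X.subtype (· ∈ B)) (by rw [hXc]; simpa using hX)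
    rw [hXc] at this
    refine le_trans ?_ this
    rw [Nat.cast_le]
    refine (Finset.card_le_card (t := (Finset.univ.filter fun a : A =>
      ∀ i, f a i ∈ X.subtype (· ∈ B)).image Subtype.val) ?_).trans Finset.card_image_le
    intro a ha
    rw [Finset.mem_filter] at ha
    dsimp only at ha
    rw [dif_pos ha.1] at ha
    refine Finset.mem_image.mpr ⟨⟨a, ha.1⟩, ?_, rfl⟩
    simp only [Finset.mem_filter, Finset.mem_univ, true_and, Finset.mem_subtype]
    exact fun i => ha.2 (Finset.mem_image_of_mem _ (Finset.mem_univ i))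

/-! ### The damaged set -/

/-- The damaged set. Given expanding neighbourhoods `nb k a ⊆ B k` for the `a ∈ A k`, where each
point lies in at most `Λ` of the sets `B k`, every set `F` can be enlarged by a factor of at most
`1 / (1 - 2ηΛ)` to a set `F'` such that for every `k` either `B k` is swallowed by `F'`, or every
point of `A k` outside `F'` keeps a neighbour outside `F'`. -/
theorem exists_damaged_superset {V κ : Type*} [Finite V] [DecidableEq V] [DecidableEq κ]
    (S : Finset κ) (A B : κ → Finset V) (nb : κ → V → Finset V) {η Λ : ℝ} (h0 : 0 ≤ η)
    (h1 : η ≤ 1) (hnb : ∀ k ∈ S, ∀ a, nb k a ⊆ B k)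
    (hexp : ∀ k ∈ S, ∀ X ⊆ B k, (X.card : ℝ) ≤ (1 - η) * (B k).card →
      (((A k).filter fun a => nb k a ⊆ X).card : ℝ) ≤ η * X.card)
    (hload : ∀ v, ((S.filter fun k => v ∈ B k).card : ℝ) ≤ Λ) (F : Finset V) :
    ∃ F' : Finset V, F ⊆ F' ∧ (1 - 2 * η * Λ) * F'.card ≤ F.card ∧
      ∀ k ∈ S, B k ⊆ F' ∨ ∀ a ∈ A k, a ∉ F' → ∃ b ∈ nb k a, b ∉ F' := by
  -- `F'` is a maximal set whose points outside `F` can be charged to the indices: index `k` pays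
  -- for the points with neighbourhood inside `X k`, and for `Z k` once `B k` is swallowed.
  let adm : Set (Finset V) := {F' | F ⊆ F' ∧ ∃ X Z : κ → Finset V,
    (∀ k ∈ S, X k ⊆ F' ∩ B k ∧ ((X k).card : ℝ) ≤ (1 - η) * (B k).card) ∧
    (∀ k ∈ S, Z k = ∅ ∨ (B k ⊆ F' ∧ ((Z k).card : ℝ) ≤ η * (B k).card)) ∧
    ∀ v ∈ F', v ∈ F ∨ ∃ k ∈ S, (v ∈ A k ∧ nb k v ⊆ X k) ∨ v ∈ Z k}
  have hF : F ∈ adm := by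
    refine ⟨subset_rfl, fun _ => ∅, fun _ => ∅, fun k _ => ⟨Finset.empty_subset _, ?_⟩,
      fun _ _ => Or.inl rfl, fun v hv => Or.inl hv⟩
    simp only [Finset.card_empty, Nat.cast_zero]
    exact mul_nonneg (by linarith) (Nat.cast_nonneg _)
  obtain ⟨F', hFF', ⟨-, X, Z, hX, hZ, hcov⟩, hmax⟩ := (Set.toFinite adm).exists_le_maximal hF
  have hmax' : ∀ F'' ∈ adm, F' ⊆ F'' → F'' ⊆ F' := fun F'' h h' => hmax h h'
  refine ⟨F', hFF', ?_, ?_⟩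
  · have hsub : F' ⊆ F ∪ S.biUnion fun k => ((A k).filter fun a => nb k a ⊆ X k) ∪ Z k := by
      intro v hv
      simp only [Finset.mem_union, Finset.mem_biUnion, Finset.mem_filter]
      rcases hcov v hv with h | ⟨k, hk, h⟩
      · exact Or.inl h
      · exact Or.inr ⟨k, hk, h⟩
    have hdouble : ∑ k ∈ S, ((F' ∩ B k).card : ℝ) ≤ Λ * F'.card := by
      have e : ∑ k ∈ S, (F' ∩ B k).card = ∑ v ∈ F', (S.filter fun k => v ∈ B k).card := by
        simp only [← Finset.filter_mem_eq_inter, Finset.card_filter]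
        exact Finset.sum_comm
      have : ∑ v ∈ F', ((S.filter fun k => v ∈ B k).card : ℝ) ≤ ∑ v ∈ F', Λ :=
        Finset.sum_le_sum fun v _ => hload v
      rw [Finset.sum_const, nsmul_eq_mul] at this
      calc ∑ k ∈ S, ((F' ∩ B k).card : ℝ) = ∑ v ∈ F', ((S.filter fun k => v ∈ B k).card : ℝ) := by
            exact_mod_cast e
        _ ≤ _ := by linarith
    have hk : ∀ k ∈ S, (((((A k).filter fun a => nb k a ⊆ X k) ∪ Z k).card : ℕ) : ℝ) ≤
        2 * η * (F' ∩ B k).card := by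
      intro k hk
      have c1 : (((((A k).filter fun a => nb k a ⊆ X k) ∪ Z k).card : ℕ) : ℝ) ≤
          ((A k).filter fun a => nb k a ⊆ X k).card + (Z k).card := by
        exact_mod_cast Finset.card_union_le _ _
      have c2 := hexp k hk (X k) ((hX k hk).1.trans Finset.inter_subset_right) (hX k hk).2
      have c3 : ((X k).card : ℝ) ≤ (F' ∩ B k).card := by
        exact_mod_cast Finset.card_le_card (hX k hk).1
      have c4 : ((Z k).card : ℝ) ≤ η * (F' ∩ B k).card := by
        rcases hZ k hk with h | ⟨h, h'⟩
        · rw [h, Finset.card_empty, Nat.cast_zero]; positivity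
        · rwa [Finset.inter_eq_right.mpr h]
      nlinarith
    have hcard : (F'.card : ℝ) ≤ F.card + ∑ k ∈ S, 2 * η * ((F' ∩ B k).card : ℝ) := by
      refine le_trans ?_ (add_le_add_right (Finset.sum_le_sum hk) _)
      have := (Finset.card_le_card hsub).trans ((Finset.card_union_le _ _).trans
        (Nat.add_le_add_left Finset.card_biUnion_le _))
      exact_mod_cast this
    rw [← Finset.mul_sum] at hcard
    nlinarith
  · intro k hk
    by_contra! hcon
    obtain ⟨hB, a, haA, haF, hnba⟩ := hcon
    rcases le_or_gt ((F' ∩ B k).card : ℝ) ((1 - η) * (B k).card) with hc | hc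
    · -- `a` can be added at the expense of `X k`.
      refine haF (hmax' (insert a F') ?_ (Finset.subset_insert _ _) (Finset.mem_insert_self _ _))
      refine ⟨hFF'.trans (Finset.subset_insert _ _), Function.update X k (F' ∩ B k), Z, ?_, ?_, ?_⟩
      · intro k' hk'
        rcases eq_or_ne k' k with rfl | hne
        · rw [Function.update_self]
          exact ⟨Finset.inter_subset_inter_right (Finset.subset_insert _ _), hc⟩
        · rw [Function.update_of_ne hne]
          exact ⟨(hX k' hk').1.trans (Finset.inter_subset_inter_right (Finset.subset_insert _ _)),
            (hX k' hk').2⟩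
      · exact fun k' hk' => (hZ k' hk').imp_right fun h =>
          ⟨h.1.trans (Finset.subset_insert _ _), h.2⟩
      · intro v hv
        rcases Finset.mem_insert.mp hv with rfl | hv
        · refine Or.inr ⟨k, hk, Or.inl ⟨haA, ?_⟩⟩
          rw [Function.update_self]
          exact Finset.subset_inter hnba (hnb k hk v)
        · refine (hcov v hv).imp_right ?_
          rintro ⟨k', hk', h⟩
          refine ⟨k', hk', h.imp_left fun h => ⟨h.1, h.2.trans ?_⟩⟩
          rcases eq_or_ne k' k with rfl | hne
          · rw [Function.update_self]; exact (hX k' hk').1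
          · rw [Function.update_of_ne hne]
    · -- The few remaining points of `B k` can be added at the expense of `Z k`.
      refine hB (Finset.subset_union_right.trans
        (hmax' (F' ∪ B k) ?_ Finset.subset_union_left))
      have hZk : Z k = ∅ := (hZ k hk).resolve_right fun h => hB h.1
      refine ⟨hFF'.trans Finset.subset_union_left, X, Function.update Z k (B k \ F'),
        ?_, ?_, ?_⟩
      · exact fun k' hk' => ⟨(hX k' hk').1.trans
          (Finset.inter_subset_inter_right Finset.subset_union_left), (hX k' hk').2⟩
      · intro k' hk'
        rcases eq_or_ne k' k with rfl | hne
        · rw [Function.update_self]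
          refine Or.inr ⟨Finset.subset_union_right, ?_⟩
          have : ((B k' \ F').card : ℝ) + (F' ∩ B k').card = (B k').card := by
            rw [Finset.inter_comm]; exact_mod_cast Finset.card_sdiff_add_card_inter _ _
          linarith
        · rw [Function.update_of_ne hne]
          exact (hZ k' hk').imp_right fun h => ⟨h.1.trans Finset.subset_union_left, h.2⟩
      · intro v hv
        by_cases hvF : v ∈ F'
        · refine (hcov v hvF).imp_right ?_
          rintro ⟨k', hk', h⟩
          refine ⟨k', hk', h.imp_right fun h => ?_⟩
          rcases eq_or_ne k' k with rfl | hne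
          · rw [hZk] at h; exact absurd h (Finset.notMem_empty _)
          · rwa [Function.update_of_ne hne]
        · refine Or.inr ⟨k, hk, Or.inr ?_⟩
          rw [Function.update_self]
          exact Finset.mem_sdiff.mpr ⟨(Finset.mem_union.mp hv).resolve_left hvF, hvF⟩

/-! ### Semi-separated pair decompositions of Euclidean point sets -/

theorem floor_two_pow_mul_div (u : ℝ) (i m : ℕ) :
    ⌊2 ^ (m + i) * u⌋₊ / 2 ^ m = ⌊2 ^ i * u⌋₊ := by
  rw [← Nat.cast_ofNat (R := ℝ), ← Nat.floor_div_natCast]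
  congr 1
  push_cast
  rw [pow_add]
  field_simp

/-- The base-`2 ^ h` digits of `2 ^ r * u`, starting with its integer part, determine and are
determined by the dyadic cells of `u` at the levels `r`, `h + r`, `2 * h + r`, …. -/
theorem digits_eq_iff_floor_eq {h r : ℕ} (hr : r ≤ h) {u u' : ℝ} (hu : u ∈ Set.Ico (0 : ℝ) 1)
    (hu' : u' ∈ Set.Ico (0 : ℝ) 1) (J : ℕ) :
    (∀ j ≤ J, ⌊2 ^ (h * j + r) * u⌋₊ % 2 ^ h = ⌊2 ^ (h * j + r) * u'⌋₊ % 2 ^ h) ↔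
      ⌊2 ^ (h * J + r) * u⌋₊ = ⌊2 ^ (h * J + r) * u'⌋₊ := by
  constructor
  · intro H
    induction J with
    | zero =>
      have lt : ∀ v ∈ Set.Ico (0 : ℝ) 1, ⌊2 ^ (h * 0 + r) * v⌋₊ < 2 ^ h := by
        intro v hv
        rw [Nat.floor_lt (mul_nonneg (by positivity) hv.1)]
        push_cast
        calc (2 : ℝ) ^ (h * 0 + r) * v < 2 ^ (h * 0 + r) * 1 :=
              mul_lt_mul_of_pos_left hv.2 (by positivity)
          _ = 2 ^ r := by simp
          _ ≤ 2 ^ h := pow_le_pow_right₀ (by norm_num) hr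
      have := H 0 le_rfl
      rwa [Nat.mod_eq_of_lt (lt u hu), Nat.mod_eq_of_lt (lt u' hu')] at this
    | succ J ih =>
      have e1 := ih fun j hj => H j (by omega)
      have e2 := H (J + 1) le_rfl
      have e3 : h * (J + 1) + r = h + (h * J + r) := by ring
      rw [e3] at e2 ⊢
      rw [← Nat.div_add_mod ⌊2 ^ (h + (h * J + r)) * u⌋₊ (2 ^ h),
        ← Nat.div_add_mod ⌊2 ^ (h + (h * J + r)) * u'⌋₊ (2 ^ h), e2,
        floor_two_pow_mul_div, floor_two_pow_mul_div, e1]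
  · intro H j hj
    obtain ⟨m, rfl⟩ := Nat.exists_eq_add_of_le hj
    have e3 : h * (j + m) + r = h * m + (h * j + r) := by ring
    rw [e3] at H
    rw [← floor_two_pow_mul_div u (h * j + r) (h * m), H, floor_two_pow_mul_div]

/-- The one-third trick: at every dyadic level coarse enough for `u` and `u'`, the grid or its
translate by `1/3` does not separate them. The two grids have breakpoints at distance at least
`1/3` of the cell size because `3` does not divide `2 ^ i`. -/
theorem floor_eq_or_floor_add_third_eq {u u' : ℝ} (hu : 0 ≤ u) (hu' : 0 ≤ u') (i : ℕ)
    (hi : 3 * (2 ^ i * |u - u'|) ≤ 1) :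
    ⌊2 ^ i * u⌋₊ = ⌊2 ^ i * u'⌋₊ ∨ ⌊2 ^ i * (u + 1 / 3)⌋₊ = ⌊2 ^ i * (u' + 1 / 3)⌋₊ := by
  wlog hle : u ≤ u' generalizing u u'
  · exact (this hu' hu (by rwa [abs_sub_comm]) (le_of_not_ge hle)).imp Eq.symm Eq.symm
  by_contra! hcon
  rw [abs_of_nonpos (by linarith)] at hi
  have h2 : (0 : ℝ) < 2 ^ i := by positivity
  have key : ∀ v v' : ℝ, 0 ≤ v → v ≤ v' → ⌊2 ^ i * v⌋₊ ≠ ⌊2 ^ i * v'⌋₊ →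
      ∃ a : ℤ, 2 ^ i * v < a ∧ (a : ℝ) ≤ 2 ^ i * v' := by
    intro v v' hv hvv hne
    have hlt : ⌊2 ^ i * v⌋₊ < ⌊2 ^ i * v'⌋₊ :=
      lt_of_le_of_ne (Nat.floor_le_floor (by gcongr)) hne
    refine ⟨⌊2 ^ i * v'⌋₊, ?_, ?_⟩
    · exact_mod_cast (Nat.floor_lt (by positivity)).mp hlt
    · have : (0 : ℝ) ≤ 2 ^ i * v' := mul_nonneg h2.le (hv.trans hvv)
      exact_mod_cast Nat.floor_le this
  obtain ⟨a, ha1, ha2⟩ := key u u' hu hle hcon.1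
  obtain ⟨b, hb1, hb2⟩ := key (u + 1 / 3) (u' + 1 / 3) (by linarith) (by linarith) hcon.2
  have e1 : ((3 * (b - a) - 2 ^ i : ℤ) : ℝ) < 1 := by push_cast; linarith
  have e2 : (-1 : ℝ) < ((3 * (b - a) - 2 ^ i : ℤ) : ℝ) := by push_cast; linarith
  have e3 : (3 * (b - a) - 2 ^ i : ℤ) < 1 := by exact_mod_cast e1
  have e4 : (-1 : ℤ) < 3 * (b - a) - 2 ^ i := by exact_mod_cast e2
  have h3 : (3 : ℤ) ∣ 2 ^ i := ⟨b - a, by omega⟩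
  have := Int.Prime.dvd_pow' (n := 2) (p := 3) (k := i) Nat.prime_three (by exact_mod_cast h3)
  norm_num at this

theorem abs_sub_le_of_floor_eq {u u' : ℝ} (hu : 0 ≤ u) (hu' : 0 ≤ u') (i : ℕ)
    (h : ⌊2 ^ i * u⌋₊ = ⌊2 ^ i * u'⌋₊) : |u - u'| ≤ 1 / 2 ^ i := by
  have h2 : (0 : ℝ) < 2 ^ i := by positivity
  have e : |u - u'| * 2 ^ i = |2 ^ i * u - 2 ^ i * u'| := by
    rw [← mul_sub, abs_mul, abs_of_pos h2, mul_comm]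
  rw [le_div_iff₀ h2, e]
  have a1 := Nat.floor_le (mul_nonneg h2.le hu)
  have a2 := Nat.lt_floor_add_one (2 ^ i * u)
  have b1 := Nat.floor_le (mul_nonneg h2.le hu')
  have b2 := Nat.lt_floor_add_one (2 ^ i * u')
  rw [h] at a1 a2
  rw [abs_le]
  constructor <;> linarith

theorem dist_le_of_forall_abs_sub_le {d : ℕ} (x y : EuclideanSpace ℝ (Fin d)) {c : ℝ} (hc : 0 ≤ c)
    (h : ∀ k, |x k - y k| ≤ c) : dist x y ≤ d * c := by
  rw [EuclideanSpace.dist_eq]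
  refine Real.sqrt_le_iff.mpr ⟨by positivity, ?_⟩
  calc ∑ k, dist (x k) (y k) ^ 2 ≤ ∑ _k : Fin d, c ^ 2 := by
        refine Finset.sum_le_sum fun k _ => ?_
        rw [Real.dist_eq]
        exact pow_le_pow_left₀ (abs_nonneg _) (h k) 2
    _ = d * c ^ 2 := by simp
    _ ≤ (d : ℝ) ^ 2 * c ^ 2 := by
        gcongr
        exact_mod_cast Nat.le_self_pow (by norm_num) d
    _ = _ := by ring

/-- Semi-separated pair decompositions of logarithmic load. For every pair of points `p`, `q` there
is a pair of sets splitting them whose larger component has diameter small compared with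
`dist p q`. The decomposition is the union of the trie decompositions for the digit expansions in
`2 ^ d` translated grids, at the levels of each residue class modulo `h`. -/
theorem exists_semiseparated_pairs (d : ℕ) {δ : ℝ} (hδ : 0 < δ) :
    ∃ C : ℕ, ∀ (P : Finset (EuclideanSpace ℝ (Fin d))) (k : ℕ), P.card ≤ 2 ^ k →
      ∃ S : Finset (Finset P × Finset P), (∀ s ∈ S, s.1.card ≤ s.2.card) ∧
        (∀ v, (S.filter fun s => v ∈ s.1 ∨ v ∈ s.2).card ≤ C * k) ∧
        ∀ p q : P, p ≠ q → ∃ s ∈ S,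
          (p ∈ s.1 ∧ q ∈ s.2 ∧ ∀ b ∈ s.2, dist b q ≤ δ * dist p q) ∨
          (q ∈ s.1 ∧ p ∈ s.2 ∧ ∀ b ∈ s.2, dist b p ≤ δ * dist p q) := by
  classical
  -- `h` levels below a cell of size comparable to `dist p q`, the cells are small enough.
  obtain ⟨h, hh⟩ := pow_unbounded_of_one_lt (6 * d / min δ (1 / 2)) (one_lt_two)
  have hδ' : 0 < min δ (1 / 2) := lt_min hδ (by norm_num)
  rw [div_lt_iff₀ hδ'] at hh
  have hh' : 6 * (d : ℝ) ≤ 2 ^ (h + 1) * min δ (1 / 2) := by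
    refine hh.le.trans ?_
    gcongr <;> norm_num
  clear hh
  generalize hH : h + 1 = H at hh'
  have hH0 : 0 < H := by omega
  refine ⟨(Finset.univ : Finset ((Fin d → Bool) × Fin H)).card *
    (2 * Fintype.card (Fin d → Fin (2 ^ H)) + 1), fun P k hk => ?_⟩
  obtain ⟨R, hR0, hR⟩ : ∃ R : ℝ, 0 < R ∧ ∀ x : P, ‖(x : EuclideanSpace ℝ (Fin d))‖ ≤ R := by
    refine ⟨1 + ∑ x : P, ‖(x : EuclideanSpace ℝ (Fin d))‖, by positivity, fun x => ?_⟩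
    have := Finset.single_le_sum (f := fun x : P => ‖(x : EuclideanSpace ℝ (Fin d))‖)
      (fun _ _ => norm_nonneg _) (Finset.mem_univ x)
    linarith
  -- Normalized coordinates lie in `[1/8, 3/8]`, and in `[0, 1)` after each translation.
  set u : P → Fin d → ℝ := fun x i => (x : EuclideanSpace ℝ (Fin d)) i / (8 * R) + 1 / 4 with hu
  have hu8 : ∀ x i, 1 / 8 ≤ u x i ∧ u x i ≤ 3 / 8 := by
    intro x i
    have h1 : |(x : EuclideanSpace ℝ (Fin d)) i| ≤ R := (PiLp.norm_apply_le _ i).trans (hR x)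
    rw [abs_le] at h1
    have e1 : (x : EuclideanSpace ℝ (Fin d)) i / (8 * R) ≤ 1 / 8 := by
      rw [div_le_div_iff₀ (by positivity) (by norm_num)]; linarith
    have e2 : -(1 / 8) ≤ (x : EuclideanSpace ℝ (Fin d)) i / (8 * R) := by
      rw [le_div_iff₀ (by positivity)]; linarith
    simp only [hu]
    constructor <;> linarith
  set y : (Fin d → Bool) → P → Fin d → ℝ := fun σ x i => u x i + if σ i then 1 / 3 else 0 with hy
  have hy01 : ∀ σ x i, y σ x i ∈ Set.Ico (0 : ℝ) 1 := by
    intro σ x i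
    have := hu8 x i
    simp only [hy]
    constructor <;> split_ifs <;> linarith
  have hsub : ∀ σ (p q : P) i, y σ p i - y σ q i =
      ((p : EuclideanSpace ℝ (Fin d)) i - (q : EuclideanSpace ℝ (Fin d)) i) / (8 * R) := by
    intro σ p q i
    simp only [hy, hu]; ring
  have hcell : ∀ σ (p q : P) (i : ℕ), (∀ l, ⌊2 ^ i * y σ p l⌋₊ = ⌊2 ^ i * y σ q l⌋₊) →
      dist p q ≤ d * (8 * R / 2 ^ i) := by
    intro σ p q i hl
    refine dist_le_of_forall_abs_sub_le _ _ (by positivity) fun l => ?_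
    have := abs_sub_le_of_floor_eq (hy01 σ p l).1 (hy01 σ q l).1 i (hl l)
    rw [hsub, abs_div, abs_of_pos (by positivity : 0 < 8 * R),
      div_le_div_iff₀ (by positivity) (by positivity)] at this
    rw [le_div_iff₀ (by positivity)]
    linarith
  set dig : (Fin d → Bool) × Fin H → P → ℕ → Fin d → Fin (2 ^ H) := fun z x j l =>
    ⟨⌊2 ^ (H * j + z.2) * y z.1 x l⌋₊ % 2 ^ H, Nat.mod_lt _ (by positivity)⟩ with hdig
  have hdigcell : ∀ z p q J, (∀ j ≤ J, dig z p j = dig z q j) ↔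
      ∀ l, ⌊2 ^ (H * J + z.2) * y z.1 p l⌋₊ = ⌊2 ^ (H * J + z.2) * y z.1 q l⌋₊ := by
    intro z p q J
    simp only [← digits_eq_iff_floor_eq z.2.2.le (hy01 z.1 p _) (hy01 z.1 q _)]
    simp only [hdig, funext_iff, Fin.ext_iff]
    exact ⟨fun H l j hj => H j hj l, fun H j hj l => H l j hj⟩
  have hsep : ∀ z, ∀ p ∈ (Finset.univ : Finset P), ∀ q ∈ (Finset.univ : Finset P), p ≠ q →
      ∃ i, dig z p i ≠ dig z q i := by
    intro z p _ q _ hne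
    by_contra! hcon
    have hpos : 0 < dist p q := dist_pos.mpr hne
    obtain ⟨J, hJ⟩ := pow_unbounded_of_one_lt (d * (8 * R) / dist p q) (one_lt_two)
    have h1 := hcell z.1 p q _ ((hdigcell z p q J).mp fun j _ => hcon j)
    have h2 : (2 : ℝ) ^ J ≤ 2 ^ (H * J + z.2) :=
      pow_le_pow_right₀ (by norm_num) (le_add_right (Nat.le_mul_of_pos_left J hH0))
    rw [div_lt_iff₀ hpos] at hJ
    rw [← mul_div_assoc, le_div_iff₀ (by positivity)] at h1
    nlinarith
  have htrie := fun z => exists_pairs_of_digits (dig z) k Finset.univ (by simpa using hk) (hsep z)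
  choose S hS1 hS2 hS3 using htrie
  refine ⟨Finset.univ.biUnion S, ?_, ?_, ?_⟩
  · intro s hs
    obtain ⟨z, -, hz⟩ := Finset.mem_biUnion.mp hs
    exact (hS1 z s hz).2.2
  · intro v
    rw [Finset.filter_biUnion, mul_assoc]
    refine Finset.card_biUnion_le.trans ?_
    rw [← smul_eq_mul (Finset.card _), ← Finset.sum_const]
    exact Finset.sum_le_sum fun z _ => hS2 z v
  · intro p q hne
    have hpos : 0 < dist p q := dist_pos.mpr hne
    set ℓ := dist p q / (8 * R) with hℓ
    have hℓ0 : 0 < ℓ := by positivity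
    have hℓ4 : ℓ ≤ 1 / 4 := by
      have : dist p q ≤ R + R := (dist_le_norm_add_norm (p : EuclideanSpace ℝ (Fin d)) q).trans
        (add_le_add (hR p) (hR q))
      rw [hℓ, div_le_div_iff₀ (by positivity) (by norm_num)]; linarith
    obtain ⟨i, hi1, hi2⟩ := exists_nat_pow_near (x := 1 / (3 * ℓ)) (y := 2)
      (by rw [le_div_iff₀ (by positivity)]; linarith) one_lt_two
    rw [le_div_iff₀ (by positivity)] at hi1
    rw [div_lt_iff₀ (by positivity), pow_succ] at hi2
    have habs : ∀ l, |u p l - u q l| ≤ ℓ := by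
      intro l
      have e : u p l - u q l = ((p : EuclideanSpace ℝ (Fin d)) l -
          (q : EuclideanSpace ℝ (Fin d)) l) / (8 * R) := by simp only [hu]; ring
      rw [e, abs_div, abs_of_pos (by positivity : 0 < 8 * R), hℓ]
      gcongr
      have := PiLp.norm_apply_le
        ((p : EuclideanSpace ℝ (Fin d)) - (q : EuclideanSpace ℝ (Fin d))) l
      rwa [← dist_eq_norm] at this
    have hshift : ∀ l, ∃ b : Bool, ⌊2 ^ i * (u p l + if b then 1 / 3 else 0)⌋₊ =
        ⌊2 ^ i * (u q l + if b then 1 / 3 else 0)⌋₊ := by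
      intro l
      have := floor_eq_or_floor_add_third_eq (u := u p l) (u' := u q l)
        (by linarith [hu8 p l]) (by linarith [hu8 q l]) i (by
          have : 2 ^ i * |u p l - u q l| ≤ 2 ^ i * ℓ := by gcongr; exact habs l
          linarith)
      rcases this with h | h
      · exact ⟨false, by simpa using h⟩
      · exact ⟨true, by simpa using h⟩
    choose σ hσ using hshift
    set z : (Fin d → Bool) × Fin H := (σ, ⟨i % H, Nat.mod_lt _ hH0⟩) with hz
    have hlevel : H * (i / H) + z.2 = i := Nat.div_add_mod i H
    have hlevel' : H * (i / H + 1) + z.2 = i + H := by rw [mul_add, mul_one]; omega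
    have hsmall : ∀ b c : P, (∀ j ≤ i / H + 1, dig z b j = dig z c j) →
        dist b c ≤ min δ (1 / 2) * dist p q := by
      intro b c hbc
      have h1 := hcell z.1 b c _ ((hdigcell z b c _).mp hbc)
      rw [hlevel', pow_add] at h1
      refine h1.trans ?_
      have hp : dist p q = ℓ * (8 * R) := by rw [hℓ]; field_simp
      rw [hp, ← mul_div_assoc, div_le_iff₀ (by positivity)]
      have e1 : (d : ℝ) ≤ d * (2 ^ i * 2 * (3 * ℓ)) := le_mul_of_one_le_right (by positivity) hi2.le
      have e2 : 6 * (d : ℝ) * (2 ^ i * ℓ) ≤ 2 ^ H * min δ (1 / 2) * (2 ^ i * ℓ) := by gcongr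
      have e3 : (d : ℝ) ≤ min δ (1 / 2) * ℓ * (2 ^ i * 2 ^ H) := by linarith
      calc (d : ℝ) * (8 * R) ≤ min δ (1 / 2) * ℓ * (2 ^ i * 2 ^ H) * (8 * R) := by gcongr
        _ = _ := by ring
    have hagree : ∀ j < i / H + 1, dig z p j = dig z q j := by
      have := (hdigcell z p q (i / H)).mpr (by rw [hlevel]; exact hσ)
      exact fun j hj => this j (by omega)
    have hdiffer : dig z p (i / H + 1) ≠ dig z q (i / H + 1) := by
      intro heq
      have := hsmall p q fun j hj => by
        rcases Nat.lt_or_eq_of_le hj with h | rfl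
        · exact hagree j h
        · exact heq
      have := mul_le_mul_of_nonneg_right (min_le_right δ (1 / 2)) hpos.le
      linarith
    have hmin : min δ (1 / 2) * dist p q ≤ δ * dist p q := by gcongr; exact min_le_left _ _
    obtain ⟨s, hs, hcase⟩ := hS3 z p (Finset.mem_univ _) q (Finset.mem_univ _) _ hagree hdiffer
    refine ⟨s, Finset.mem_biUnion.mpr ⟨z, Finset.mem_univ _, hs⟩, ?_⟩
    exact hcase.imp (fun h => ⟨h.1, h.2.1, fun b hb => (hsmall b q (h.2.2 b hb)).trans hmin⟩)
      (fun h => ⟨h.1, h.2.1, fun b hb => (hsmall b p (h.2.2 b hb)).trans hmin⟩)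

/-! ### The spanner -/

theorem walkLength_cons {V : Type*} [MetricSpace V] {G : SimpleGraph V} {u v w : V}
    (h : G.Adj u v) (p : G.Walk v w) :
    walkLength (SimpleGraph.Walk.cons h p) = dist u v + walkLength p := by
  simp [walkLength]

theorem walkLength_concat {V : Type*} [MetricSpace V] {G : SimpleGraph V} {u v w : V}
    (p : G.Walk u v) (h : G.Adj v w) : walkLength (p.concat h) = walkLength p + dist v w := by
  simp [walkLength, SimpleGraph.Walk.darts_concat]

/-- If for any two surviving points one of them has a surviving neighbour near the other one, then
surviving points are connected by short paths: go to that neighbour and proceed by induction on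
the distance. -/
theorem isSpannerOf_of_forall_exists_adj {V : Type*} [Finite V] [MetricSpace V]
    (G : SimpleGraph V) {F F' : Finset V} (hF : F ⊆ F') {δ t : ℝ} (hδ0 : 0 ≤ δ) (hδ1 : δ < 1)
    (ht : 1 + δ + t * δ ≤ t)
    (H : ∀ p q, p ≠ q → p ∉ F' → q ∉ F' → ∃ r, r ∉ F' ∧
      ((G.Adj p r ∧ dist r q ≤ δ * dist p q) ∨ (G.Adj q r ∧ dist r p ≤ δ * dist p q))) :
    IsSpannerOf (G.induce {v : V | v ∉ F}) t {v | (v : V) ∉ F'} := by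
  have ht0 : 0 ≤ t := by nlinarith
  set W := {v : V | v ∉ F}
  have walks : ∀ z : W × W, (z.1 : V) ∉ F' → (z.2 : V) ∉ F' →
      ∃ w : (G.induce W).Walk z.1 z.2, walkLength w ≤ t * dist z.1 z.2 := by
    let R : W × W → W × W → Prop := InvImage (· < ·) fun z => dist z.1 z.2
    have : IsTrans (W × W) R := ⟨fun _ _ _ => lt_trans⟩
    have : Std.Irrefl R := ⟨fun _ => lt_irrefl _⟩
    intro z
    induction z using (Finite.wellFounded_of_trans_of_irrefl R).induction with
    | _ z ih =>
    obtain ⟨p, q⟩ := z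
    intro hp hq
    dsimp only at hp hq ⊢
    rcases eq_or_ne p q with rfl | hne
    · exact ⟨SimpleGraph.Walk.nil, by simp [walkLength]⟩
    have hpos : 0 < dist p q := dist_pos.mpr hne
    have hstep : δ * dist p q < dist p q := mul_lt_of_lt_one_left hpos hδ1
    have hlen := mul_le_mul_of_nonneg_right ht hpos.le
    obtain ⟨r, hr, ⟨hadj, hd⟩ | ⟨hadj, hd⟩⟩ :=
      H p q (fun h => hne (Subtype.ext h)) hp hq
    · let r' : W := ⟨r, fun h => hr (hF h)⟩
      have hd' : dist r' q ≤ δ * dist p q := hd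
      obtain ⟨w, hw⟩ := ih (r', q) (hd'.trans_lt hstep) hr hq
      have hadj' : (G.induce W).Adj p r' := hadj
      refine ⟨SimpleGraph.Walk.cons hadj' w, ?_⟩
      rw [walkLength_cons]
      dsimp only at hw
      have h1 : dist p r' ≤ dist p q + dist r' q := by
        rw [dist_comm r' q]; exact dist_triangle _ _ _
      have h2 := mul_le_mul_of_nonneg_left hd' ht0
      linarith
    · let r' : W := ⟨r, fun h => hr (hF h)⟩
      have hd' : dist p r' ≤ δ * dist p q := by rw [dist_comm p r']; exact hd
      obtain ⟨w, hw⟩ := ih (p, r') (hd'.trans_lt hstep) hp hr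
      have hadj' : (G.induce W).Adj r' q := hadj.symm
      refine ⟨w.concat hadj', ?_⟩
      rw [walkLength_concat]
      dsimp only at hw
      have h1 : dist r' q ≤ dist p r' + dist p q := by
        rw [dist_comm p r']; exact dist_triangle _ _ _
      have h2 := mul_le_mul_of_nonneg_left hd' ht0
      linarith
  intro p hp q hq hne
  obtain ⟨w, hw⟩ := walks (p, q) hp hq
  dsimp only at w hw
  rw [ENNReal.div_le_iff (by simpa using hne) (edist_ne_top p q)]
  calc graphDist (G.induce W) p q ≤ ENNReal.ofReal (walkLength w) := iInf_le _ w
    _ ≤ ENNReal.ofReal (t * dist p q) := ENNReal.ofReal_le_ofReal hw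
    _ = ENNReal.ofReal t * edist p q := by rw [ENNReal.ofReal_mul ht0, edist_dist]

/-- The spanner built from a semi-separated pair decomposition: the points of the smaller component
of each pair are joined to the larger one by an expander. -/
theorem exists_resilientSpanner_of_pairs {V : Type*} [Fintype V] [MetricSpace V]
    [DecidableEq V] (S : Finset (Finset V × Finset V)) {Λ D : ℕ} {ε t δ η : ℝ}
    (hcard : ∀ s ∈ S, s.1.card ≤ s.2.card)
    (hload : ∀ v, (S.filter fun s => v ∈ s.1 ∨ v ∈ s.2).card ≤ Λ)
    (hsep : ∀ p q : V, p ≠ q → ∃ s ∈ S,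
      (p ∈ s.1 ∧ q ∈ s.2 ∧ ∀ b ∈ s.2, dist b q ≤ δ * dist p q) ∨
      (q ∈ s.1 ∧ p ∈ s.2 ∧ ∀ b ∈ s.2, dist b p ≤ δ * dist p q))
    (hε : 0 < ε) (hδ0 : 0 ≤ δ) (hδ1 : δ < 1) (ht : 1 + δ + t * δ ≤ t) (hη0 : 0 < η)
    (hη1 : η ≤ 1 / 2) (hηΛ : 2 * η * Λ * (1 + ε) ≤ ε)
    (hD : 30 / η * Real.log (1 / η) ≤ D) :
    ∃ G : SimpleGraph V, IsResilientSpanner G ε t ∧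
      G.edgeSet.ncard ≤ D * (Λ * Fintype.card V) := by
  have hex : ∀ s : Finset V × Finset V, ∃ nb : V → Finset V, s ∈ S →
      (∀ a, nb a ⊆ s.2 ∧ (nb a).card ≤ D) ∧
      ∀ X ⊆ s.2, (X.card : ℝ) ≤ (1 - η) * s.2.card →
        ((s.1.filter fun a => nb a ⊆ X).card : ℝ) ≤ η * X.card := by
    intro s
    by_cases hs : s ∈ S
    · obtain ⟨nb, h⟩ := exists_expander s.1 s.2 (hcard s hs) hη0 hη1 hD
      exact ⟨nb, fun _ => h⟩
    · exact ⟨fun _ => ∅, fun h => absurd h hs⟩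
  choose nb hnb using hex
  let G : SimpleGraph V := SimpleGraph.fromRel fun p q => ∃ s ∈ S, p ∈ s.1 ∧ q ∈ nb s p
  have hadj : ∀ s ∈ S, ∀ p ∈ s.1, ∀ q ∈ nb s p, p ≠ q → G.Adj p q := fun s hs p hp q hq hne =>
    (SimpleGraph.fromRel_adj _ _ _).mpr ⟨hne, Or.inl ⟨s, hs, hp, hq⟩⟩
  refine ⟨G, ?_, ?_⟩
  · intro F
    obtain ⟨F', hFF', hsize, hF'⟩ := exists_damaged_superset S Prod.fst Prod.snd nb hη0.le
      (by linarith) (fun s hs a => ((hnb s hs).1 a).1) (fun s hs => (hnb s hs).2)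
      (Λ := Λ) (fun v => by
        refine Nat.cast_le.mpr ((Finset.card_le_card fun s hs => ?_).trans (hload v))
        rw [Finset.mem_filter] at hs ⊢
        exact ⟨hs.1, Or.inr hs.2⟩) F
    refine ⟨F', hFF', ?_, ?_⟩
    · have h1 := mul_le_mul_of_nonneg_left hsize (by linarith : 0 ≤ 1 + ε)
      have h2 := mul_le_mul_of_nonneg_right hηΛ (Nat.cast_nonneg (α := ℝ) F'.card)
      dsimp only
      linarith
    · -- A survivor of the larger component of a pair forces each survivor of the smaller one to
      -- have a surviving neighbour there.
      have step : ∀ p q, p ≠ q → p ∉ F' → q ∉ F' → ∀ s ∈ S, p ∈ s.1 → q ∈ s.2 →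
          (∀ b ∈ s.2, dist b q ≤ δ * dist p q) →
          ∃ r, r ∉ F' ∧ G.Adj p r ∧ dist r q ≤ δ * dist p q := by
        intro p q hne hp hq s hs hps hqs hb
        rcases hF' s hs with h | h
        · exact absurd (h hqs) hq
        · obtain ⟨r, hr, hrF⟩ := h p hps hp
          have hrq := hb r (((hnb s hs).1 p).1 hr)
          refine ⟨r, hrF, hadj s hs p hps r hr ?_, hrq⟩
          rintro rfl
          have := dist_pos.mpr hne
          nlinarith
      refine isSpannerOf_of_forall_exists_adj G hFF' hδ0 hδ1 ht fun p q hne hp hq => ?_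
      obtain ⟨s, hs, ⟨h1, h2, h3⟩ | ⟨h1, h2, h3⟩⟩ := hsep p q hne
      · obtain ⟨r, hr, h⟩ := step p q hne hp hq s hs h1 h2 h3
        exact ⟨r, hr, Or.inl h⟩
      · obtain ⟨r, hr, h⟩ := step q p hne.symm hq hp s hs h1 h2 (by rwa [dist_comm q p])
        exact ⟨r, hr, Or.inr ⟨h.1, by rw [dist_comm p q]; exact h.2⟩⟩
  · have hsub : G.edgeSet ⊆ ((S.biUnion fun s => s.1.biUnion fun a =>
        (nb s a).image fun b => s(a, b) : Finset (Sym2 V)) : Set (Sym2 V)) := by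
      intro e he
      induction e using Sym2.ind with
      | _ p q =>
      rw [SimpleGraph.mem_edgeSet, SimpleGraph.fromRel_adj] at he
      simp only [Finset.coe_biUnion, Set.mem_iUnion, Finset.mem_coe, Finset.mem_image]
      rcases he.2 with ⟨s, hs, hp, hq⟩ | ⟨s, hs, hq, hp⟩
      · exact ⟨s, hs, p, hp, q, hq, rfl⟩
      · exact ⟨s, hs, q, hq, p, hp, Sym2.eq_swap⟩
    have hdouble : ∑ s ∈ S, s.1.card ≤ Λ * Fintype.card V := by
      have e : ∑ s ∈ S, s.1.card = ∑ v : V, (S.filter fun s => v ∈ s.1).card := by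
        simp only [Finset.card_filter]
        rw [Finset.sum_comm]
        refine Finset.sum_congr rfl fun s _ => ?_
        rw [← Finset.card_filter, Finset.filter_univ_mem]
      rw [e, mul_comm, ← Finset.card_univ, ← smul_eq_mul, ← Finset.sum_const]
      refine Finset.sum_le_sum fun v _ => (Finset.card_le_card fun s hs => ?_).trans (hload v)
      rw [Finset.mem_filter] at hs ⊢
      exact ⟨hs.1, Or.inl hs.2⟩
    calc G.edgeSet.ncard ≤ _ := Set.ncard_le_ncard hsub (Finset.finite_toSet _)
      _ ≤ ∑ s ∈ S, s.1.card * D := by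
          rw [Set.ncard_coe_finset]
          refine Finset.card_biUnion_le.trans (Finset.sum_le_sum fun s hs => ?_)
          exact Finset.card_biUnion_le_card_mul _ _ _ fun a _ =>
            Finset.card_image_le.trans ((hnb s hs).1 a).2
      _ ≤ _ := by
          rw [← Finset.sum_mul, mul_comm]
          exact Nat.mul_le_mul_left D hdouble

theorem clog_le_three_mul_log {n : ℕ} (hn : 3 ≤ n) : (Nat.clog 2 n : ℝ) ≤ 3 * Real.log n := by
  have hn0 : (0 : ℝ) < n := by positivity
  have h3 : Real.log 3 ≤ Real.log n := Real.log_le_log (by norm_num) (by exact_mod_cast hn)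
  have h1 : (1 : ℝ) ≤ Real.log 3 := by
    rw [Real.le_log_iff_exp_le (by norm_num)]; linarith [Real.exp_one_lt_d9]
  have hlt := Nat.pow_pred_clog_lt_self one_lt_two (by omega : 1 < n)
  have hlog : ((Nat.clog 2 n).pred : ℝ) * Real.log 2 ≤ Real.log n := by
    rw [← Real.log_pow]
    exact Real.log_le_log (by positivity) (by exact_mod_cast hlt.le)
  have hpred : (Nat.clog 2 n : ℝ) = (Nat.clog 2 n).pred + 1 := by
    have := Nat.succ_pred_eq_of_pos (Nat.clog_pos one_lt_two (by omega : 1 < n))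
    exact_mod_cast this.symm
  have hlog2 := Real.log_two_gt_d9
  have hc0 : (0 : ℝ) ≤ (Nat.clog 2 n).pred := Nat.cast_nonneg _
  nlinarith

end GeometricGraph

theorem theorem1 (d : ℕ) (hd : 1 ≤ d) (ε : ℝ) (hε : 0 < ε) (t : ℝ) (ht : 1 < t) :
    ∃ C : ℝ, ∀ P : Finset (EuclideanSpace ℝ (Fin d)), ∃ G : SimpleGraph {x // x ∈ P},
      GeometricGraph.IsResilientSpanner G ε t ∧
      (3 ≤ P.card →
        (G.edgeSet.ncard : ℝ) ≤
          C * (P.card * Real.log P.card ^ 2 * Real.log (Real.log P.card))) := by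
  classical
  have hδ0 : 0 < (t - 1) / (t + 1) := div_pos (by linarith) (by linarith)
  have hδ1 : (t - 1) / (t + 1) < 1 := by rw [div_lt_one (by linarith)]; linarith
  have hδt : 1 + (t - 1) / (t + 1) + t * ((t - 1) / (t + 1)) ≤ t := by
    have h : (t + 1) * ((t - 1) / (t + 1)) = t - 1 := mul_div_cancel₀ _ (by linarith)
    linarith
  obtain ⟨c, hc⟩ := GeometricGraph.exists_semiseparated_pairs d hδ0
  set K : ℝ := 4 * (1 + ε) / ε with hK
  have hK4 : 4 ≤ K := by rw [hK, le_div_iff₀ hε]; linarith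
  set c₀ : ℝ := Real.log (Real.log 3) with hc₀
  have hlog3 : 1 < Real.log 3 := by
    rw [Real.lt_log_iff_exp_lt (by norm_num)]; linarith [Real.exp_one_lt_d9]
  have hc₀0 : 0 < c₀ := Real.log_pos hlog3
  set K₁ : ℝ := K * (3 * c + 1) with hK₁
  have hK₁4 : 4 ≤ K₁ := hK4.trans (le_mul_of_one_le_right (by linarith)
    (by linarith [Nat.cast_nonneg (α := ℝ) c]))
  refine ⟨(30 * K₁ * (Real.log K₁ / c₀ + 1) + 1 / c₀) * (3 * c), fun P => ?_⟩
  obtain ⟨S, hS1, hS2, hS3⟩ := hc P (Nat.clog 2 P.card) (Nat.le_pow_clog one_lt_two _)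
  -- With load `Λ`, the damage may grow by a factor of `1 + O(ηΛ)`.
  set Λ : ℕ := c * Nat.clog 2 P.card with hΛ
  have hΛ0 : (0 : ℝ) ≤ Λ := Nat.cast_nonneg _
  set η : ℝ := 1 / (K * (Λ + 1)) with hη
  have hη0 : 0 < η := by positivity
  have hη1 : η ≤ 1 / 2 := by
    rw [hη]
    exact one_div_le_one_div_of_le (by norm_num) (by nlinarith)
  have hηΛ : 2 * η * Λ * (1 + ε) ≤ ε := by
    have e1 : η * (Λ + 1) * (4 * (1 + ε)) = ε := by
      rw [hη, hK]; field_simp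
    nlinarith [mul_nonneg hη0.le hΛ0]
  obtain ⟨G, hG, hE⟩ := GeometricGraph.exists_resilientSpanner_of_pairs S hS1 hS2 hS3 hε hδ0.le
    hδ1 hδt hη0 hη1 hηΛ (Nat.le_ceil _)
  refine ⟨G, hG, fun hn => ?_⟩
  have hclog := GeometricGraph.clog_le_three_mul_log hn
  rw [Fintype.card_coe] at hE
  set n := P.card
  have hn3 : Real.log 3 ≤ Real.log n := Real.log_le_log (by norm_num) (by exact_mod_cast hn)
  have hl1 : 1 ≤ Real.log n := hlog3.le.trans hn3
  have hLL : c₀ ≤ Real.log (Real.log n) := Real.log_le_log (by linarith) hn3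
  set l := Real.log n
  set L := Real.log l
  have hL0 : 0 < L := hc₀0.trans_le hLL
  have hΛl : (Λ : ℝ) ≤ 3 * c * l := by
    rw [hΛ]; push_cast
    calc (c : ℝ) * Nat.clog 2 n ≤ c * (3 * l) := by gcongr
      _ = _ := by ring
  have hηinv : 1 / η = K * (Λ + 1) := by rw [hη, one_div_one_div]
  have hηl : 1 / η ≤ K₁ * l := by
    rw [hηinv, hK₁, mul_assoc]
    gcongr
    linarith
  have hlogη : Real.log (1 / η) ≤ (Real.log K₁ / c₀ + 1) * L := by
    have h1 : Real.log (1 / η) ≤ Real.log K₁ + L := by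
      rw [← Real.log_mul (by linarith) (by linarith)]
      exact Real.log_le_log (by positivity) hηl
    have h2 : Real.log K₁ ≤ Real.log K₁ / c₀ * L := by
      have h0 : 0 ≤ Real.log K₁ := Real.log_nonneg (by linarith)
      rw [div_mul_eq_mul_div, le_div_iff₀ hc₀0]
      gcongr
    linarith
  have hlogη0 : 0 ≤ Real.log (1 / η) :=
    Real.log_nonneg (by rw [le_div_iff₀ hη0]; linarith)
  have hD : (⌈30 / η * Real.log (1 / η)⌉₊ : ℝ) ≤
      (30 * K₁ * (Real.log K₁ / c₀ + 1) + 1 / c₀) * (l * L) := by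
    have h1 : 30 / η * Real.log (1 / η) ≤ 30 * (K₁ * l) * ((Real.log K₁ / c₀ + 1) * L) := by
      have : 30 / η = 30 * (1 / η) := by ring
      rw [this]
      gcongr
    have h2 : 1 ≤ 1 / c₀ * (l * L) := by
      rw [one_div_mul_eq_div, le_div_iff₀ hc₀0, one_mul]
      exact hLL.trans (le_mul_of_one_le_left hL0.le hl1)
    have h3 := (Nat.ceil_lt_add_one (mul_nonneg (by positivity : 0 ≤ 30 / η) hlogη0)).le
    linarith
  calc (G.edgeSet.ncard : ℝ)
      ≤ (⌈30 / η * Real.log (1 / η)⌉₊ : ℝ) * (Λ * n) := by exact_mod_cast hE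
    _ ≤ (30 * K₁ * (Real.log K₁ / c₀ + 1) + 1 / c₀) * (l * L) * (3 * c * l * n) := by
        gcongr
        exact (Nat.cast_nonneg _).trans hD
    _ = _ := by ring
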